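/- Let $R$ be a commutative noetherian ring, let $I, J$ be ideals of $R$, let $M$ be an $R$-module (not necessarily finitely generated), and let $t \ge 0$ be an integer. Put $$\tilde W(I,J) = \{\mathfrak a \subseteq R \text{ an ideal} \mid I^n \subseteq \mathfrak a + J \text{ for all sufficiently large } n\}.$$ For an $R$-module $X$ let $$\Gamma_{I,J}(X) = \{x \in X \mid I^n x \subseteq Jx \text{ for all sufficiently large } n\}$$ and, for an ideal $\mathfrak a$ of $R$, let $$\Gamma_{\mathfrak a}(X) = \{x \in X \mid \mathfrak a^n x = 0 \text{ for some } n\}.$$ Let $H^i_{I,J}$ and $H^i_{\mathfrak a}$ denote the $i$-th right derived functors of $\Gamma_{I,J}$ and $\Gamma_{\mathfrak a}$, respectively. Then $H^i_{I,J}(M) = 0$ for all $0 \le i < t$ if and only if $H^i_{\mathfrak a}(M) = 0$ for every $\mathfrak a \in \tilde W(I,J)$ and all $0 \le i < t$. -/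

import Mathlib

open CategoryTheory

universe u v

noncomputable section

namespace PairLocalCohomology

section Modules

variable {R : Type u} [CommRing R]

/-- `W̃(I, J)`: the set of ideals `𝔞` of `R` with `I ^ n ⊆ 𝔞 + J` for `n ≫ 1`. The condition on `n`
passes to larger exponents, so "for all large `n`" is the same as "for some `n`". -/
def WTilde (I J : Ideal R) : Set (Ideal R) :=
  {𝔞 | ∃ n : ℕ, I ^ n ≤ 𝔞 ⊔ J}

/-- The `(I, J)`-torsion submodule
`Γ_{I,J}(M) = {x ∈ M | I ^ n x ⊆ J x for n ≫ 1}`. The condition on `n` passes to larger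
exponents, so "for all large `n`" is the same as "for some `n`". -/
def pairTorsion (I J : Ideal R) (M : Type v) [AddCommGroup M] [Module R M] : Submodule R M where
  carrier := {x | ∃ n : ℕ, ∀ r ∈ I ^ n, ∃ j ∈ J, r • x = j • x}
  zero_mem' := ⟨0, fun _ _ => ⟨0, J.zero_mem, by simp⟩⟩
  add_mem' := by
    rintro x y ⟨n, hn⟩ ⟨m, hm⟩
    refine ⟨n + m, fun r hr => ?_⟩
    rw [pow_add] at hr
    induction hr using Submodule.mul_induction_on' with
    | mem_mul_mem a ha b hb =>
      obtain ⟨j, hj, hjx⟩ := hn a ha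
      obtain ⟨k, hk, hky⟩ := hm b hb
      -- `(a - j) (b - k)` kills both `x` and `y`
      refine ⟨a * k + j * b - j * k, ?_, ?_⟩
      · exact J.sub_mem (J.add_mem (J.mul_mem_left _ hk) (J.mul_mem_right _ hj))
          (J.mul_mem_left _ hk)
      · have h1 : (a * b) • x = (a * k + j * b - j * k) • x := by
          have : (b - k) • (a • x) = (b - k) • (j • x) := by rw [hjx]
          rw [smul_smul, smul_smul, ← sub_eq_zero, ← sub_smul] at this
          rw [← sub_eq_zero, ← sub_smul, ← this]
          congr 1
          ring
        have h2 : (a * b) • y = (a * k + j * b - j * k) • y := by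
          have : (a - j) • (b • y) = (a - j) • (k • y) := by rw [hky]
          rw [smul_smul, smul_smul, ← sub_eq_zero, ← sub_smul] at this
          rw [← sub_eq_zero, ← sub_smul, ← this]
          congr 1
          ring
        rw [smul_add, smul_add, h1, h2]
    | add a _ b _ ha hb =>
      obtain ⟨j, hj, hjx⟩ := ha
      obtain ⟨k, hk, hkx⟩ := hb
      exact ⟨j + k, J.add_mem hj hk, by rw [add_smul, add_smul, hjx, hkx]⟩
  smul_mem' := by
    rintro c x ⟨n, hn⟩
    refine ⟨n, fun r hr => ?_⟩
    obtain ⟨j, hj, hjx⟩ := hn r hr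
    exact ⟨j, hj, by rw [smul_comm r c, hjx, smul_comm c j]⟩

/-- The `𝔞`-torsion submodule `Γ_𝔞(M) = {x ∈ M | 𝔞 ^ n x = 0 for some n}`. -/
def idealTorsion (𝔞 : Ideal R) (M : Type v) [AddCommGroup M] [Module R M] : Submodule R M where
  carrier := {x | ∃ n : ℕ, ∀ r ∈ 𝔞 ^ n, r • x = 0}
  zero_mem' := ⟨0, fun _ _ => smul_zero _⟩
  add_mem' := by
    rintro x y ⟨n, hn⟩ ⟨m, hm⟩
    refine ⟨n + m, fun r hr => ?_⟩
    rw [smul_add, hn r (Ideal.pow_le_pow_right (Nat.le_add_right n m) hr),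
      hm r (Ideal.pow_le_pow_right (Nat.le_add_left m n) hr), add_zero]
  smul_mem' := by
    rintro c x ⟨n, hn⟩
    exact ⟨n, fun r hr => by rw [smul_comm, hn r hr, smul_zero]⟩

variable {M N : Type v} [AddCommGroup M] [Module R M] [AddCommGroup N] [Module R N]

theorem map_mem_pairTorsion (I J : Ideal R) (f : M →ₗ[R] N) :
    ∀ x ∈ pairTorsion I J M, f x ∈ pairTorsion I J N := by
  rintro x ⟨n, hn⟩
  refine ⟨n, fun r hr => ?_⟩
  obtain ⟨j, hj, hjx⟩ := hn r hr
  exact ⟨j, hj, by rw [← map_smul, hjx, map_smul]⟩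

theorem map_mem_idealTorsion (𝔞 : Ideal R) (f : M →ₗ[R] N) :
    ∀ x ∈ idealTorsion 𝔞 M, f x ∈ idealTorsion 𝔞 N := by
  rintro x ⟨n, hn⟩
  exact ⟨n, fun r hr => by rw [← map_smul, hn r hr, map_zero]⟩

end Modules

section Functors

variable {R : Type u} [CommRing R]

/-- The `(I, J)`-torsion functor `Γ_{I,J}` on `R`-modules; on morphisms it is restriction. -/
def pairTorsionFunctor (I J : Ideal R) : ModuleCat.{v} R ⥤ ModuleCat.{v} R where
  obj M := ModuleCat.of R (pairTorsion I J M)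
  map f := ModuleCat.ofHom (f.hom.restrict (map_mem_pairTorsion I J f.hom))

/-- The `𝔞`-torsion functor `Γ_𝔞` on `R`-modules; on morphisms it is restriction. -/
def idealTorsionFunctor (𝔞 : Ideal R) : ModuleCat.{v} R ⥤ ModuleCat.{v} R where
  obj M := ModuleCat.of R (idealTorsion 𝔞 M)
  map f := ModuleCat.ofHom (f.hom.restrict (map_mem_idealTorsion 𝔞 f.hom))

instance (I J : Ideal R) : (pairTorsionFunctor.{u, v} I J).Additive where
  map_add := rfl

instance (𝔞 : Ideal R) : (idealTorsionFunctor.{u, v} 𝔞).Additive where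
  map_add := rfl

variable [Small.{v} R]

/-- `H^i_{I,J}(M)`, the `i`-th right derived functor of `Γ_{I,J}` evaluated at `M`. -/
def pairLocalCohomology (I J : Ideal R) (i : ℕ) (M : Type v) [AddCommGroup M] [Module R M] :
    ModuleCat.{v} R :=
  ((pairTorsionFunctor.{u, v} I J).rightDerived i).obj (ModuleCat.of R M)

/-- `H^i_𝔞(M)`, the `i`-th right derived functor of `Γ_𝔞` evaluated at `M`. -/
def idealLocalCohomology (𝔞 : Ideal R) (i : ℕ) (M : Type v) [AddCommGroup M] [Module R M] :
    ModuleCat.{v} R :=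
  ((idealTorsionFunctor.{u, v} 𝔞).rightDerived i).obj (ModuleCat.of R M)

end Functors

end PairLocalCohomology

end

/-! The key fact is that `Γ_{I,J}(X)` is the union of the `Γ_𝔞(X)` over `𝔞 ∈ W̃(I,J)`
(`mem_pairTorsion_iff_exists_WTilde`), so one side vanishes exactly when all the others do. Induct
on `t`, for all `M` at once. If `Γ_{I,J}(M) ≠ 0`, both conditions fail in degree 0. Otherwise an
essential injective extension `E` of `M` has no `(I,J)`-torsion, hence no `𝔞`-torsion, and dimension
shifting along `0 → M → E → N → 0` reduces both conditions to `N` and `t - 1`. -/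

namespace PairLocalCohomology

/-! ### Dimension shifting for right derived functors. -/

section DimensionShift

variable {C D : Type*} [Category* C] [Category* D] [Abelian C] [Abelian D]

/-- The coaugmentation `X ⟶ P⁰` of an injective resolution `P` of `X`. -/
noncomputable def coaugmentation {X : C} (P : InjectiveResolution X) : X ⟶ P.cocomplex.X 0 :=
  P.ι.f 0

instance {X : C} (P : InjectiveResolution X) : Mono (coaugmentation P) :=
  inferInstanceAs (Mono (P.ι.f 0))

@[simp]
theorem coaugmentation_comp_d {X : C} (P : InjectiveResolution X) :
    coaugmentation P ≫ P.cocomplex.d 0 1 = 0 :=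
  P.ι_f_zero_comp_complex_d

theorem exact_coaugmentation {X : C} (P : InjectiveResolution X) :
    (ShortComplex.mk _ _ (coaugmentation_comp_d P)).Exact :=
  P.exact₀

/-- An injective resolution of the cokernel of a monomorphism into an injective object gives, by
splicing, an injective resolution of the source. -/
noncomputable def spliceResolution {S : ShortComplex C} (hS : S.ShortExact) [Injective S.X₂]
    (P : InjectiveResolution S.X₃) : InjectiveResolution S.X₁ where
  cocomplex := CochainComplex.augment P.cocomplex (S.g ≫ coaugmentation P) (by simp)
  injective n := by
    cases n
    · exact inferInstanceAs (Injective S.X₂)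
    · exact P.injective _
  ι := (CochainComplex.fromSingle₀Equiv _ _).symm ⟨S.f,
    show S.f ≫ S.g ≫ coaugmentation P = 0 from (S.zero_assoc _).trans Limits.zero_comp⟩
  quasiIso := ⟨fun n => by
    have := hS.mono_f
    have := hS.epi_g
    rcases n with _ | _ | n
    · rw [CochainComplex.quasiIsoAt₀_iff, ShortComplex.quasiIso_iff_of_zeros]
      · let α : S ⟶ ShortComplex.mk S.f (S.g ≫ coaugmentation P) (by simp) :=
          { τ₁ := 𝟙 _
            τ₂ := 𝟙 _
            τ₃ := coaugmentation P }
        refine (ShortComplex.exact_and_mono_f_iff_of_iso ?_).2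
          ⟨(ShortComplex.exact_iff_of_epi_of_isIso_of_mono α).1 hS.exact, hS.mono_f⟩
        refine ShortComplex.isoMk (Iso.refl _) (Iso.refl _) (Iso.refl _) ?_ ?_
        · refine (Category.id_comp _).trans (Eq.trans ?_ (Category.comp_id _).symm)
          exact (CochainComplex.fromSingle₀Equiv_symm_apply_f_zero
            (C := CochainComplex.augment P.cocomplex (S.g ≫ coaugmentation P) (by simp)) S.f _).symm
        · exact (Category.id_comp _).trans (Category.comp_id _).symm
      all_goals rfl
    · rw [quasiIsoAt_iff_exactAt]
      · rw [HomologicalComplex.exactAt_iff' _ 0 1 2 (by simp) (by simp)]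
        let α : ShortComplex.mk (S.g ≫ coaugmentation P) (P.cocomplex.d 0 1) (by simp) ⟶
            ShortComplex.mk _ _ (coaugmentation_comp_d P) :=
          { τ₁ := S.g
            τ₂ := 𝟙 _
            τ₃ := 𝟙 _ }
        exact (ShortComplex.exact_iff_of_epi_of_isIso_of_mono α).2 (exact_coaugmentation P)
      · apply CochainComplex.exactAt_succ_single_obj
    · rw [quasiIsoAt_iff_exactAt]
      · rw [HomologicalComplex.exactAt_iff' _ (n + 1) (n + 2) (n + 3) (by simp) (by simp)]
        exact P.exact_succ n
      · apply CochainComplex.exactAt_succ_single_obj⟩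

variable [HasInjectiveResolutions C]

theorem isZero_rightDerived_iff_exactAt (F : C ⥤ D) [F.Additive] {X : C}
    (P : InjectiveResolution X) (n : ℕ) :
    Limits.IsZero ((F.rightDerived n).obj X) ↔
      ((F.mapHomologicalComplex _).obj P.cocomplex).ExactAt n := by
  rw [HomologicalComplex.exactAt_iff_isZero_homology]
  exact (P.isoRightDerivedObj F n).isZero_iff

theorem exactAt_zero_iff_mono (K : CochainComplex D ℕ) : K.ExactAt 0 ↔ Mono (K.d 0 1) := by
  -- The predecessor of degree 0 is 0 itself, and `d 0 0 = 0`.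
  rw [HomologicalComplex.exactAt_iff' K 0 0 1 (by simp) (by simp)]
  exact ShortComplex.exact_iff_mono _ (K.shape _ _ (by simp))

/-- Dimension shifting along an injective object which `F` annihilates. -/
theorem isZero_rightDerived_succ_iff (F : C ⥤ D) [F.Additive] {S : ShortComplex C}
    (hS : S.ShortExact) [Injective S.X₂] (h₂ : Limits.IsZero (F.obj S.X₂)) (n : ℕ) :
    Limits.IsZero ((F.rightDerived (n + 1)).obj S.X₁) ↔
      Limits.IsZero ((F.rightDerived n).obj S.X₃) := by
  let P := injectiveResolution S.X₃
  rw [isZero_rightDerived_iff_exactAt F (spliceResolution hS P),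
    isZero_rightDerived_iff_exactAt F P]
  cases n with
  | zero =>
    rw [exactAt_zero_iff_mono, HomologicalComplex.exactAt_iff' _ 0 1 2 (by simp) (by simp)]
    -- The map into degree 1 of the spliced complex starts at `F(X₂) = 0`.
    exact ShortComplex.exact_iff_mono _ (h₂.eq_of_src _ _)
  | succ n =>
    rw [HomologicalComplex.exactAt_iff' _ n (n + 1) (n + 2) (by simp) (by simp),
      HomologicalComplex.exactAt_iff' _ (n + 1) (n + 2) (n + 3) (by simp) (by simp)]
    rfl

theorem isZero_rightDerived_zero_of_isZero (F : C ⥤ D) [F.Additive] {S : ShortComplex C}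
    (hS : S.ShortExact) [Injective S.X₂] (h₂ : Limits.IsZero (F.obj S.X₂)) :
    Limits.IsZero ((F.rightDerived 0).obj S.X₁) := by
  rw [isZero_rightDerived_iff_exactAt F (spliceResolution hS (injectiveResolution S.X₃)),
    exactAt_zero_iff_mono]
  exact ⟨fun _ _ _ => h₂.eq_of_tgt _ _⟩

/-- Left exactness is not needed: the mono `F(X) ⟶ F(P⁰)` is killed by `F(d)`, which is itself mono
by the vanishing. -/
theorem isZero_obj_of_isZero_rightDerived_zero (F : C ⥤ D) [F.Additive]
    [F.PreservesMonomorphisms] {X : C} (h : Limits.IsZero ((F.rightDerived 0).obj X)) :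
    Limits.IsZero (F.obj X) := by
  let P := injectiveResolution X
  rw [isZero_rightDerived_iff_exactAt F P, exactAt_zero_iff_mono] at h
  have hd : F.map (coaugmentation P) ≫ F.map (P.cocomplex.d 0 1) = 0 := by
    rw [← F.map_comp, coaugmentation_comp_d, F.map_zero]
  have : Mono (F.map (P.cocomplex.d 0 1)) := h
  exact Limits.IsZero.of_mono_eq_zero (F.map (coaugmentation P)) (Limits.zero_of_comp_mono _ hd)

/-- The vanishing of the first right derived functors, by recursion along an injective object. -/
theorem forall_lt_succ_isZero_rightDerived_iff (F : C ⥤ D) [F.Additive] {S : ShortComplex C}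
    (hS : S.ShortExact) [Injective S.X₂] (h₂ : Limits.IsZero (F.obj S.X₂)) (t : ℕ) :
    (∀ i < t + 1, Limits.IsZero ((F.rightDerived i).obj S.X₁)) ↔
      ∀ i < t, Limits.IsZero ((F.rightDerived i).obj S.X₃) := by
  rw [Nat.forall_lt_succ_left']
  simp only [isZero_rightDerived_succ_iff F hS h₂]
  exact and_iff_right (isZero_rightDerived_zero_of_isZero F hS h₂)

end DimensionShift

/-! ### Existence of essential injective extensions. -/

section InjectiveHull

/-- Every module embeds into an injective module as an essential submodule. -/
theorem exists_essential_injective {R : Type u} [CommRing R] [Small.{v} R] (M : ModuleCat.{v} R) :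
    ∃ (E : ModuleCat.{v} R) (f : M ⟶ E), Injective E ∧ Mono f ∧
      ∀ x : E, x ≠ 0 → ∃ (r : R) (m : M), r • x ≠ 0 ∧ f.hom m = r • x := by
  obtain ⟨⟨Q, hQ, ι, hι⟩⟩ := EnoughInjectives.presentation M
  let g : M →ₗ[R] Q := ι.hom
  have hg : Function.Injective g := (ModuleCat.mono_iff_injective ι).1 hι
  let ess : Set (Submodule R Q) :=
    {E | LinearMap.range g ≤ E ∧ ∀ x ∈ E, x ≠ 0 → ∃ r : R, r • x ≠ 0 ∧ r • x ∈ LinearMap.range g}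
  -- `E` is a maximal essential extension of the image of `M` inside `Q`; it will be a retract of
  -- `Q`, hence injective.
  obtain ⟨E, -, hE⟩ := zorn_le_nonempty₀ ess (by
    intro c hc hchain E₀ hE₀
    refine ⟨sSup c, ⟨(hc hE₀).1.trans (le_sSup hE₀), fun x hx hx0 => ?_⟩, fun _ => le_sSup⟩
    obtain ⟨E, hE, hxE⟩ := (Submodule.mem_sSup_of_directed ⟨E₀, hE₀⟩ hchain.directedOn).1 hx
    exact (hc hE).2 x hxE hx0) (LinearMap.range g)
    ⟨le_rfl, fun x hx hx0 => ⟨1, by simpa using hx0, by simpa using hx⟩⟩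
  obtain ⟨K, -, hK⟩ := zorn_le_nonempty₀ {K : Submodule R Q | Disjoint K E} (by
    intro c hc hchain K₀ hK₀
    refine ⟨sSup c, ?_, fun _ => le_sSup⟩
    refine Submodule.disjoint_def.2 fun x hx hxE => ?_
    obtain ⟨K, hK, hxK⟩ := (Submodule.mem_sSup_of_directed ⟨K₀, hK₀⟩ hchain.directedOn).1 hx
    exact Submodule.disjoint_def.1 (hc hK) x hxK hxE) ⊥ disjoint_bot_left
  have hKE := Submodule.disjoint_def.1 hK.prop
  -- `E` is essential in `Q ⧸ K`
  have hquot : ∀ y : Q ⧸ K, y ≠ 0 → ∃ (r : R), ∃ e ∈ E, e ≠ 0 ∧ K.mkQ e = r • y := by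
    intro y hy
    obtain ⟨x, rfl⟩ := K.mkQ_surjective y
    by_contra! hcon
    refine hy ?_
    have hd : Disjoint (K ⊔ Submodule.span R {x}) E := by
      refine Submodule.disjoint_def.2 fun e he heE => ?_
      obtain ⟨k, hk, z, hz, rfl⟩ := Submodule.mem_sup.1 he
      obtain ⟨r, rfl⟩ := Submodule.mem_span_singleton.1 hz
      by_contra h0
      refine hcon r _ heE h0 ?_
      rw [map_add, map_smul, show K.mkQ k = 0 from (Submodule.Quotient.mk_eq_zero K).2 hk,
        zero_add]
    have hle := hK.le_of_ge hd le_sup_left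
    exact (Submodule.Quotient.mk_eq_zero K).2
      (hle (Submodule.mem_sup_right (Submodule.mem_span_singleton_self x)))
  let j : ModuleCat.of R E ⟶ ModuleCat.of R (Q ⧸ K) := ModuleCat.ofHom (K.mkQ ∘ₗ E.subtype)
  have hj : Mono j := (ModuleCat.mono_iff_injective j).2 <| by
    refine (injective_iff_map_eq_zero j.hom).2 fun e he => ?_
    exact Subtype.ext (hKE _ ((Submodule.Quotient.mk_eq_zero K).1 he) e.2)
  let i : ModuleCat.of R E ⟶ Q := ModuleCat.ofHom E.subtype
  let φ : ModuleCat.of R (Q ⧸ K) ⟶ Q := Injective.factorThru i j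
  have hφ : ∀ e ∈ E, φ.hom (K.mkQ e) = e := fun e he =>
    congr($(Injective.comp_factorThru i j).hom ⟨e, he⟩)
  -- The image of `φ` is still essential over the image of `M`, as `E` is essential in `Q ⧸ K`;
  -- maximality of `E` leaves no room.
  have hrange : LinearMap.range φ.hom = E := by
    refine le_antisymm (hE.le_of_ge ⟨?_, ?_⟩ ?_) ?_
    · exact hE.prop.1.trans fun e he => ⟨_, hφ e he⟩
    · rintro _ ⟨y, rfl⟩ hy
      obtain ⟨r, e, he, he0, hr⟩ := hquot y (by rintro rfl; exact hy (map_zero _))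
      have h1 : e = r • φ.hom y := by rw [← map_smul, ← hr, hφ e he]
      obtain ⟨s, hs0, hs⟩ := hE.prop.2 e he he0
      exact ⟨s * r, by rwa [mul_smul, ← h1], by rwa [mul_smul, ← h1]⟩
    all_goals exact fun e he => ⟨_, hφ e he⟩
  let ret : Retract (ModuleCat.of R E) Q :=
    { i := i
      r := ModuleCat.ofHom ((φ.hom ∘ₗ K.mkQ).codRestrict E fun x => hrange ▸ ⟨_, rfl⟩)
      retract := by
        refine ModuleCat.hom_ext (LinearMap.ext fun e => ?_)
        exact Subtype.ext (hφ e.1 e.2) }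
  refine ⟨ModuleCat.of R E, ModuleCat.ofHom (g.codRestrict E fun m => hE.prop.1 ⟨m, rfl⟩),
    ret.injective, (ModuleCat.mono_iff_injective _).2 fun a b hab => hg congr(($hab).1), ?_⟩
  rintro ⟨x, hx⟩ hx0
  obtain ⟨r, hr, m, hm⟩ := hE.prop.2 x hx fun h => hx0 (Subtype.ext h)
  exact ⟨r, m, fun h => hr congr(($h).1), Subtype.ext hm⟩

end InjectiveHull

/-! ### Comparison of the torsion functors. -/

section Torsion

variable {R : Type u} [CommRing R]

theorem mem_pairTorsion_iff_exists_WTilde {I J : Ideal R} {M : Type v} [AddCommGroup M]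
    [Module R M] {x : M} :
    x ∈ pairTorsion I J M ↔ ∃ 𝔞 ∈ WTilde I J, x ∈ idealTorsion 𝔞 M := by
  constructor
  · rintro ⟨n, hn⟩
    -- The annihilator of `x` serves as `𝔞`, with exponent 1.
    refine ⟨Ideal.torsionOf R M x, ⟨n, fun r hr => ?_⟩, 1, fun r hr => by simpa using hr⟩
    obtain ⟨j, hj, h⟩ := hn r hr
    exact Submodule.mem_sup.2 ⟨r - j, by simp [sub_smul, h], j, hj, by simp⟩
  · rintro ⟨𝔞, ⟨n, hn⟩, k, hk⟩
    -- `I ^ (n(k+1)) ⊆ (𝔞 + J) ^ (k+1) ⊆ 𝔞 ^ k + J`, and `𝔞 ^ k` kills `x`.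
    refine ⟨n * (k + 1), fun r hr => ?_⟩
    rw [pow_mul] at hr
    obtain ⟨a, ha, j, hj, rfl⟩ := Submodule.mem_sup.1
      (Ideal.sup_pow_add_le_pow_sup_pow (Ideal.pow_right_mono hn (k + 1) hr))
    rw [pow_one] at hj
    exact ⟨j, hj, by rw [add_smul, hk a ha, zero_add]⟩

theorem mem_pairTorsion_of_map_mem {I J : Ideal R} {M N : Type v} [AddCommGroup M] [Module R M]
    [AddCommGroup N] [Module R N] (f : M →ₗ[R] N) (hf : Function.Injective f) {x : M}
    (hx : f x ∈ pairTorsion I J N) : x ∈ pairTorsion I J M := by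
  obtain ⟨n, hn⟩ := hx
  refine ⟨n, fun r hr => ?_⟩
  obtain ⟨j, hj, h⟩ := hn r hr
  exact ⟨j, hj, hf (by rw [map_smul, map_smul, h])⟩

instance (I J : Ideal R) : (pairTorsionFunctor.{u, v} I J).PreservesMonomorphisms where
  preserves f hf := (ModuleCat.mono_iff_injective _).2 fun _ _ h =>
    Subtype.ext ((ModuleCat.mono_iff_injective f).1 hf congr(($h).1))

instance (𝔞 : Ideal R) : (idealTorsionFunctor.{u, v} 𝔞).PreservesMonomorphisms where
  preserves f hf := (ModuleCat.mono_iff_injective _).2 fun _ _ h =>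
    Subtype.ext ((ModuleCat.mono_iff_injective f).1 hf congr(($h).1))

theorem isZero_pairTorsionFunctor_obj_iff (I J : Ideal R) (M : ModuleCat.{v} R) :
    Limits.IsZero ((pairTorsionFunctor I J).obj M) ↔ pairTorsion I J M = ⊥ := by
  rw [ModuleCat.isZero_iff_subsingleton]
  exact Submodule.subsingleton_iff_eq_bot

theorem isZero_idealTorsionFunctor_obj_iff (𝔞 : Ideal R) (M : ModuleCat.{v} R) :
    Limits.IsZero ((idealTorsionFunctor 𝔞).obj M) ↔ idealTorsion 𝔞 M = ⊥ := by
  rw [ModuleCat.isZero_iff_subsingleton]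
  exact Submodule.subsingleton_iff_eq_bot

theorem isZero_pairTorsionFunctor_obj_iff_forall (I J : Ideal R) (M : ModuleCat.{v} R) :
    Limits.IsZero ((pairTorsionFunctor I J).obj M) ↔
      ∀ 𝔞 ∈ WTilde I J, Limits.IsZero ((idealTorsionFunctor 𝔞).obj M) := by
  simp only [isZero_pairTorsionFunctor_obj_iff, isZero_idealTorsionFunctor_obj_iff,
    Submodule.eq_bot_iff, mem_pairTorsion_iff_exists_WTilde]
  exact ⟨fun h 𝔞 h𝔞 x hx => h x ⟨𝔞, h𝔞, hx⟩, fun h x ⟨𝔞, h𝔞, hx⟩ => h 𝔞 h𝔞 x hx⟩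

variable [Small.{v} R]

/-- A module without `(I, J)`-torsion embeds into an injective module without `(I, J)`-torsion. -/
theorem exists_shortExact_injective_isZero (I J : Ideal R) (M : ModuleCat.{v} R)
    (hM : Limits.IsZero ((pairTorsionFunctor I J).obj M)) :
    ∃ (E N : ModuleCat.{v} R) (f : M ⟶ E) (g : E ⟶ N) (w : f ≫ g = 0), Injective E ∧
      (ShortComplex.mk f g w).ShortExact ∧ Limits.IsZero ((pairTorsionFunctor I J).obj E) := by
  obtain ⟨E, f, hE, hf, hess⟩ := exists_essential_injective M
  refine ⟨E, _, f, Limits.cokernel.π f, Limits.cokernel.condition f, hE,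
    { exact := ShortComplex.exact_cokernel f }, ?_⟩
  rw [isZero_pairTorsionFunctor_obj_iff, Submodule.eq_bot_iff] at hM ⊢
  intro x hx
  by_contra hx0
  -- By essentiality a nonzero torsion element of `E` would have a nonzero multiple in `M`, again
  -- torsion.
  obtain ⟨r, m, hr, hm⟩ := hess x hx0
  have := hM m (mem_pairTorsion_of_map_mem f.hom ((ModuleCat.mono_iff_injective f).1 hf)
    (hm ▸ Submodule.smul_mem _ r hx))
  exact hr (by rw [← hm, this, map_zero])

theorem forall_isZero_rightDerived_pairTorsionFunctor_iff (I J : Ideal R) (t : ℕ)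
    (M : ModuleCat.{v} R) :
    (∀ i < t, Limits.IsZero (((pairTorsionFunctor.{u, v} I J).rightDerived i).obj M)) ↔
      ∀ 𝔞 ∈ WTilde I J, ∀ i < t,
        Limits.IsZero (((idealTorsionFunctor.{u, v} 𝔞).rightDerived i).obj M) := by
  induction t generalizing M with
  | zero => simp
  | succ t ih =>
    by_cases hM : Limits.IsZero ((pairTorsionFunctor I J).obj M)
    · obtain ⟨E, N, f, g, w, hE, hS, hz⟩ := exists_shortExact_injective_isZero I J M hM
      have : Injective (ShortComplex.mk f g w).X₂ := hE
      refine (forall_lt_succ_isZero_rightDerived_iff _ hS hz t).trans ((ih N).trans ?_)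
      exact forall₂_congr fun 𝔞 h𝔞 => (forall_lt_succ_isZero_rightDerived_iff _ hS
        ((isZero_pairTorsionFunctor_obj_iff_forall I J E).1 hz 𝔞 h𝔞) t).symm
    · refine iff_of_false (fun h => hM ?_) (fun h => hM ?_)
      · exact isZero_obj_of_isZero_rightDerived_zero _ (h 0 t.succ_pos)
      · exact (isZero_pairTorsionFunctor_obj_iff_forall I J M).2 fun 𝔞 h𝔞 =>
          isZero_obj_of_isZero_rightDerived_zero _ (h 𝔞 h𝔞 0 t.succ_pos)

end Torsion

end PairLocalCohomology

theorem corollary2p7 {R : Type u} [CommRing R] [IsNoetherianRing R] [Small.{v} R]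
    (I J : Ideal R) (M : Type v) [AddCommGroup M] [Module R M] (t : ℕ) :
    (∀ i < t, Limits.IsZero (PairLocalCohomology.pairLocalCohomology I J i M)) ↔
      ∀ 𝔞 ∈ PairLocalCohomology.WTilde I J, ∀ i < t,
        Limits.IsZero (PairLocalCohomology.idealLocalCohomology 𝔞 i M) :=
  PairLocalCohomology.forall_isZero_rightDerived_pairTorsionFunctor_iff I J t (ModuleCat.of R M)
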